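/- Let $F\in\mathbb{R}[X,Y]$ be a homogeneous form of degree $d\ge 0$, and write $F=\sum_{k=0}^d\binom dk c_kX^kY^{d-k}$. Let $R=\mathbb{R}[x,y]$ act on $\mathbb{R}[X,Y]$ by $x\circ F=\partial F/\partial X$, $y\circ F=\partial F/\partial Y$, let $\operatorname{Ann}(F)=\{f\in R : f\circ F=0\}$ and $A_F=R/\operatorname{Ann}(F)$, and let $s=\max_{0\le j\le d}\dim_{\mathbb R}(A_F)_j$ be the Sperner number of $F$. For $i\ge 0$ with $2i\le d$ define the $i$-th Hessian polynomial $$H_i^F(X,Y)=(-1)^{\lfloor (i+1)/2\rfloor}\det\left(\frac{\partial^{2i}F}{\partial X^{p+q}\,\partial Y^{2i-p-q}}\right)_{0\le p,q\le i},$$ and the $(i+1)\times(d-i+1)$ Toeplitz matrix $\phi^i_d(F)=\left(c_{i-p+q}\right)_{0\le p\le i,\ 0\le q\le d-i}$. For integers $1\le m\le n$ and an $m$-subset $J=\{j_1<\cdots<j_m\}$ of $[n]=\{1,\dots,n\}$, let $\Delta_J(A)$ be the maximal minor of an $m\times n$ matrix $A$ on the columns $J$; let $\lambda(J)$ be the partition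 with parts $\lambda_k=j_{m-k+1}-(m-k+1)$, $1\le k\le m$, of size $|\lambda(J)|=\sum_k\lambda_k$; let $\lambda'(J)$ be the conjugate partition, with parts $\lambda'_k=\#\{a : \lambda_a\ge k\}$, $1\le k\le n-m$; and put $$N'_J=\prod_{1\le a<b\le n-m}\frac{\lambda'_a-\lambda'_b-a+b}{b-a}.$$ **Lemma (Plücker expansion of the Hessian).** Let $0\le i\le s-1$ and $D_i=(i+1)(d-2i)$. Then $2i\le d$; for every $J\in\binom{[d-i+1]}{i+1}$ one has $|\lambda(J)|\le D_i$, and $N'_J$ is the number of semistandard Young tableaux of shape $\lambda'(J)$ with entries in $[d-2i]$; and, as an identity in $\mathbb{R}[X,Y]$, $$H_i^F(X,Y)=\left(\frac{d!}{(d-2i)!}\right)^{i+1}\sum_{J\in\binom{[d-i+1]}{i+1}}N'_J\cdot\Delta_J\!\left(\phi^i_d(F)\right)\cdot X^{|\lambda(J)|}\,Y^{D_i-|\lambda(J)|}.$$ -/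

import Mathlib

open MvPolynomial

/-- The polynomial ring `ℝ[X, Y]`, with `X` the variable `0` and `Y` the variable `1`. -/
abbrev BiPoly : Type := MvPolynomial (Fin 2) ℝ

noncomputable section

/-- Partial differentiation with respect to variable `j`, as a linear endomorphism of `ℝ[X, Y]`. -/
def partialD (j : Fin 2) : Module.End ℝ BiPoly := (pderiv j : Derivation ℝ BiPoly BiPoly).toLinearMap

theorem partialD_commute : Commute (partialD 0) (partialD 1) := by
  have h : ∀ F : BiPoly, pderiv (0 : Fin 2) (pderiv (1 : Fin 2) F)
      = pderiv (1 : Fin 2) (pderiv (0 : Fin 2) F) := by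
    intro F
    have h2 : ⁅(pderiv 0 : Derivation ℝ BiPoly BiPoly), (pderiv 1 : Derivation ℝ BiPoly BiPoly)⁆ = 0 := by
      apply MvPolynomial.derivation_ext
      intro k
      fin_cases k <;> simp [Derivation.commutator_apply, pderiv_X]
    have h3 := congrArg (fun D : Derivation ℝ BiPoly BiPoly => D F) h2
    simp only [Derivation.commutator_apply, Derivation.coe_zero, Pi.zero_apply] at h3
    exact sub_eq_zero.mp h3
  exact LinearMap.ext h

/-- The exponent vector `m` acts as the operator `∂^(m 0 + m 1) / ∂X^(m 0) ∂Y^(m 1)`. -/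
def monomialAction : Multiplicative (Fin 2 →₀ ℕ) →* Module.End ℝ BiPoly where
  toFun m := partialD 0 ^ (Multiplicative.toAdd m 0) * partialD 1 ^ (Multiplicative.toAdd m 1)
  map_one' := by simp
  map_mul' a b := by
    have h := partialD_commute.pow_pow (Multiplicative.toAdd b 0) (Multiplicative.toAdd a 1)
    simp only [toAdd_mul, Finsupp.add_apply, pow_add]
    rw [mul_assoc, mul_assoc, ← mul_assoc (partialD 0 ^ (Multiplicative.toAdd b 0)), h.eq]
    simp only [mul_assoc]

/-- The action `f ∘ F` of `R = ℝ[x, y]` on `Q = ℝ[X, Y]` by partial differentiation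
(`x` acts as `∂/∂X` and `y` as `∂/∂Y`), as an algebra homomorphism into `End(Q)`. -/
def diffAction : BiPoly →ₐ[ℝ] Module.End ℝ BiPoly :=
  AddMonoidAlgebra.lift ℝ (Module.End ℝ BiPoly) (Fin 2 →₀ ℕ) monomialAction

/-- The annihilator ideal `Ann(F) = {f ∈ R | f ∘ F = 0}`. -/
def annIdeal (F : BiPoly) : Ideal BiPoly where
  carrier := {f | diffAction f F = 0}
  add_mem' := by
    intro a b ha hb
    simp only [Set.mem_ofPred_eq] at *
    simp [ha, hb]
  zero_mem' := by simp
  smul_mem' := by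
    intro c f hf
    simp only [Set.mem_ofPred_eq] at *
    simp [hf]

/-- The Artinian Gorenstein algebra `A_F = R / Ann(F)`. -/
abbrev AGAlgebra (F : BiPoly) : Type := BiPoly ⧸ annIdeal F

/-- The degree `j` component of `A_F`: the image of the forms of degree `j`. -/
def gradedPiece (F : BiPoly) (j : ℕ) : Submodule ℝ (AGAlgebra F) :=
  (homogeneousSubmodule (Fin 2) ℝ j).map (Ideal.Quotient.mkₐ ℝ (annIdeal F)).toLinearMap

/-- The Hilbert function `h_j = dim_ℝ (A_F)_j`. -/
def hilbertFn (F : BiPoly) (j : ℕ) : ℕ := Module.finrank ℝ (gradedPiece F j)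

/-- The Sperner number `s(F) = max {h_j | 0 ≤ j ≤ d}` of a form `F` of degree `d`. -/
def spernerNumber (d : ℕ) (F : BiPoly) : ℕ := (Finset.range (d + 1)).sup (hilbertFn F)

/-- The `i`-th Hessian matrix, with entries `∂^(2i) F / ∂X^(p+q) ∂Y^(2i-p-q)`, `0 ≤ p, q ≤ i`. -/
def hessianMatrix (i : ℕ) (F : BiPoly) : Matrix (Fin (i + 1)) (Fin (i + 1)) BiPoly :=
  Matrix.of fun p q =>
    (pderiv 0)^[(p : ℕ) + (q : ℕ)] ((pderiv 1)^[2 * i - ((p : ℕ) + (q : ℕ))] F)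

/-- The `i`-th Hessian polynomial `H_i^F = (-1)^⌊(i+1)/2⌋ det Hess_i(F)`. -/
def hessianPoly (i : ℕ) (F : BiPoly) : BiPoly :=
  (-1) ^ ((i + 1) / 2) * (hessianMatrix i F).det

/-- The normalized coefficients: `F = ∑ₖ (d choose k) cₖ X^k Y^(d-k)` for a form `F` of degree `d`. -/
def normCoeff (d : ℕ) (F : BiPoly) (k : ℕ) : ℝ :=
  coeff (Finsupp.single 0 k + Finsupp.single 1 (d - k)) F / (d.choose k : ℝ)

/-- The `(i+1) × (d-i+1)` Toeplitz matrix with first row `c_i, …, c_d` and last row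
`c_0, …, c_(d-i)`. -/
def toeplitz (d i : ℕ) (F : BiPoly) : Matrix (Fin (i + 1)) (Fin (d - i + 1)) ℝ :=
  Matrix.of fun p q => normCoeff d F (i - (p : ℕ) + (q : ℕ))

end

/-- The `m`-subsets of an `n`-element set, which is `{0, …, n-1}` in place of `{1, …, n}`. -/
abbrev SubsetsOf (n m : ℕ) : Type := {J : Finset (Fin n) // J.card = m}

namespace SubsetsOf

variable {n m : ℕ}

/-- The maximal minor (Plücker coordinate) `Δ_J(A)` of an `m × n` matrix. -/
noncomputable def minor (J : SubsetsOf n m) (A : Matrix (Fin m) (Fin n) ℝ) : ℝ :=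
  (A.submatrix id (J.1.orderEmbOfFin J.2)).det

/-- The parts of `λ(J)`: with 1-based indices and `J = {i_1 < ⋯ < i_m}`, the `k`-th part is
`i_(m-k+1) - (m-k+1)`. Here elements and positions are both shifted by one, so the difference is
the same, and `Fin.rev k` is the position `m - 1 - k`. -/
def part (J : SubsetsOf n m) (k : Fin m) : ℕ :=
  (J.1.orderEmbOfFin J.2 k.rev : ℕ) - (k.rev : ℕ)

/-- The size `|λ(J)|`. -/
def size (J : SubsetsOf n m) : ℕ := ∑ k, J.part k

/-- The parts of the conjugate partition `λ'(J)`: `λ'_k = #{a | λ_a ≥ k}` for `1 ≤ k ≤ n - m`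
(the index `k` is 0-based here). -/
def conjPart (J : SubsetsOf n m) (k : Fin (n - m)) : ℕ :=
  (Finset.univ.filter fun a : Fin m => (k : ℕ) + 1 ≤ J.part a).card

theorem conjPart_antitone (J : SubsetsOf n m) : Antitone J.conjPart := by
  intro a b hab
  refine Finset.card_le_card fun x hx => ?_
  have h : (a : ℕ) ≤ b := hab
  simp only [Finset.mem_filter, Finset.mem_univ, true_and] at *
  omega

/-- The Young diagram of the conjugate partition `λ'(J)`. -/
def conjDiagram (J : SubsetsOf n m) : YoungDiagram :=
  YoungDiagram.ofRowLens (List.ofFn J.conjPart) J.conjPart_antitone.sortedGE_ofFn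

/-- `N'_J = ∏_{1 ≤ a < b ≤ n-m} (λ'_a - λ'_b - a + b) / (b - a)`. -/
noncomputable def weylNumber (J : SubsetsOf n m) : ℝ :=
  ∏ a : Fin (n - m), ∏ b ∈ Finset.Ioi a,
    ((J.conjPart a : ℝ) - (J.conjPart b : ℝ) - ((a : ℕ) : ℝ) + ((b : ℕ) : ℝ)) /
      (((b : ℕ) : ℝ) - ((a : ℕ) : ℝ))

end SubsetsOf

/-- The semistandard Young tableaux of shape `μ` with entries in `{1, …, N}`. -/
def BoundedSSYT (μ : YoungDiagram) (N : ℕ) : Type :=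
  {T : SemistandardYoungTableau μ // ∀ a b : ℕ, (a, b) ∈ μ → 1 ≤ T a b ∧ T a b ≤ N}

/-! Derivatives of a binary form written with binomially normalized coefficients are again such
forms, with shifted coefficients. Reversing the rows of the Hessian matrix therefore factors it as a
scalar times the Toeplitz matrix times a band matrix with entries `binom(d-2i, r-q) X^(r-q)
Y^(d-2i-r+q)` (`hessianMatrix_submatrix_rev`). The sign of the reversal is the sign in the
definition of the Hessian polynomial, and Cauchy–Binet expands the product over subsets `J`.

In a minor of the band matrix all Leibniz terms carry the same monomial, so it remains to evaluate
`det binom(n-m, j_p - q)`, with `n = d-i+1` and `m = i+1`. Instead of the dual Jacobi–Trudi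
identity, this determinant and `N'_J` are both shown to be multiples, by constants independent of
`J`, of the Vandermonde product of the complement of `J`; the constants agree because both
quantities are 1 at the initial segment (`binomDet_eq_weylNumber`).

The tableau count uses that the numbers `a + m - λ'_a` enumerate the complement of `J`. Then `N'_J`
is a determinant of binomial coefficients, whose branching rule is the removal of the largest entry
from a tableau.

Finally `2i ≤ d` holds because the Hilbert function at `j` is at most `min(j, d-j) + 1`. -/

/-! ### Binomial determinants and Vandermonde products -/

/-- The determinant of the evaluations of polynomials of degree less than `m` at `m` points is a
constant multiple of the Vandermonde product of the points. -/
theorem det_eval_eq_mul_vandermonde {R : Type*} [CommRing R] {m : ℕ} (f : Fin m → Polynomial R)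
    (hf : ∀ q, (f q).natDegree < m) (v : Fin m → R) :
    (Matrix.of fun p q => (f q).eval (v p)).det =
      (Matrix.of fun r q : Fin m => (f q).coeff r).det * (Matrix.vandermonde v).det := by
  rw [mul_comm, ← Matrix.det_mul]
  congr 1
  ext p q
  simp only [Matrix.of_apply, Matrix.mul_apply, Matrix.vandermonde_apply]
  rw [Polynomial.eval_eq_sum_range' (hf q), Finset.sum_range]
  exact Finset.sum_congr rfl fun _ _ => mul_comm _ _

/-- The determinant of the binomial coefficients `(c a).choose b`. -/
noncomputable def chooseDet {N : ℕ} (c : Fin N → ℕ) : ℝ :=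
  (Matrix.of fun a b : Fin N => ((c a).choose b : ℝ)).det

/-- Column `b` evaluates the polynomial `x(x-1)⋯(x-b+1)/b!`, of degree `b < N`. The constant is left
open; the value at `c a = a` determines it later. -/
theorem exists_chooseDet_eq_mul_vandermonde (N : ℕ) :
    ∃ K : ℝ, ∀ c : Fin N → ℕ,
      chooseDet c = K * (Matrix.vandermonde fun a => (c a : ℝ)).det := by
  let f : Fin N → Polynomial ℝ := fun b =>
    Polynomial.C (((b : ℕ).factorial : ℝ)⁻¹) * descPochhammer ℝ b
  have hf : ∀ b, (f b).natDegree < N := fun b => by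
    refine lt_of_le_of_lt (Polynomial.natDegree_C_mul_le _ _) ?_
    rw [descPochhammer_natDegree]
    exact b.2
  refine ⟨(Matrix.of fun r q : Fin N => (f q).coeff r).det, fun c => ?_⟩
  rw [← det_eval_eq_mul_vandermonde f hf]
  unfold chooseDet
  congr 1
  ext a b
  simp only [Matrix.of_apply, f, Polynomial.eval_mul, Polynomial.eval_C]
  rw [Nat.cast_choose_eq_descPochhammer_div]
  field_simp

theorem chooseDet_val (N : ℕ) : chooseDet (fun a : Fin N => (a : ℕ)) = 1 := by
  unfold chooseDet
  rw [Matrix.det_of_isLowerTriangular]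
  · simp
  · intro a b hab
    simp only [Matrix.of_apply]
    rw [Nat.choose_eq_zero_of_lt (by simpa using hab)]
    simp

theorem chooseDet_eq_prod {N : ℕ} (c : Fin N → ℕ) :
    chooseDet c = ∏ a : Fin N, ∏ b ∈ Finset.Ioi a,
      ((c b : ℝ) - (c a : ℝ)) / (((b : ℕ) : ℝ) - ((a : ℕ) : ℝ)) := by
  obtain ⟨K, hK⟩ := exists_chooseDet_eq_mul_vandermonde N
  have h1 := hK (fun a => (a : ℕ))
  rw [chooseDet_val] at h1
  simp only [Finset.prod_div_distrib]
  rw [hK c, ← Matrix.det_vandermonde, ← Matrix.det_vandermonde, eq_div_iff]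
  · linear_combination (-(Matrix.vandermonde fun a => (c a : ℝ)).det) * h1
  · intro h
    rw [h] at h1
    simp at h1

theorem sum_Ico_choose {x y : ℕ} (h : x ≤ y) (b : ℕ) :
    ∑ z ∈ Finset.Ico x y, (z.choose b : ℝ) = (y.choose (b + 1) : ℝ) - (x.choose (b + 1) : ℝ) := by
  induction y, h using Nat.le_induction with
  | base => simp
  | succ y hxy ih =>
    rw [Finset.sum_Ico_succ_top hxy, ih, Nat.choose_succ_succ]
    push_cast
    ring

/-- The branching rule for `chooseDet`. -/
theorem sum_chooseDet_interlacing {N : ℕ} (c : Fin (N + 1) → ℕ) (hc : Monotone c) :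
    ∑ z ∈ Fintype.piFinset (fun a : Fin N => Finset.Ico (c a.castSucc) (c a.succ)), chooseDet z =
      chooseDet c := by
  -- Differences of consecutive rows turn column 0 into `(1, 0, …, 0)`. Expanding along it leaves
  -- rows that are telescoping sums over the intervals, and multilinearity pulls these sums out.
  let M : Matrix (Fin (N + 1)) (Fin (N + 1)) ℝ := Matrix.of fun a b =>
    Fin.cases ((c 0).choose b : ℝ)
      (fun a' => ((c a'.succ).choose b : ℝ) - ((c a'.castSucc).choose b : ℝ)) a
  have h1 : chooseDet c = M.det := by
    refine Matrix.det_eq_of_forall_row_eq_smul_add_pred (fun _ => 1) (fun b => ?_) fun a b => ?_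
    · simp [M]
    · simp [M]
  have h2 : M.det = (M.submatrix Fin.succ Fin.succ).det := by
    rw [Matrix.det_succ_column_zero, Fin.sum_univ_succ, Finset.sum_eq_zero]
    · simp [M]
    · intro a _
      simp [M]
  rw [h1, h2]
  have h3 := (Matrix.detRowAlternating (R := ℝ) (n := Fin N)).toMultilinearMap.map_sum_finset
    (fun _ z => fun b : Fin N => (z.choose b : ℝ))
    (fun a : Fin N => Finset.Ico (c a.castSucc) (c a.succ))
  refine h3.symm.trans ?_
  refine congrArg Matrix.det ?_
  ext a b
  simp only [Finset.sum_apply, Matrix.submatrix_apply, M, Matrix.of_apply, Fin.cases_succ]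
  rw [sum_Ico_choose (hc a.castSucc_lt_succ.le)]
  simp

/-! ### Counting tableaux by removing the largest entry -/

/-- `T` is a semistandard filling with entries in `{1, …, N}` of the rows of lengths `f`,
extended by zero. -/
structure IsTableau (f : ℕ → ℕ) (N : ℕ) (T : ℕ → ℕ → ℕ) : Prop where
  bound : ∀ {a b}, b < f a → 1 ≤ T a b ∧ T a b ≤ N
  zeros : ∀ {a b}, f a ≤ b → T a b = 0
  row_weak : ∀ {a b₁ b₂}, b₁ < b₂ → b₂ < f a → T a b₁ ≤ T a b₂
  col_strict : ∀ {a₁ a₂ b}, a₁ < a₂ → b < f a₂ → T a₁ b < T a₂ b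

/-- Extend a filling of the rows of lengths `g` by the value `v` to the rows of lengths `f`. -/
def extendFilling (f g : ℕ → ℕ) (v : ℕ) (T : ℕ → ℕ → ℕ) (a b : ℕ) : ℕ :=
  if b < g a then T a b else if b < f a then v else 0

/-- The condition `f (a + 1) ≤ g a` makes the added cells a horizontal strip, so no column receives
the new value twice. -/
theorem IsTableau.extendFilling {f g : ℕ → ℕ} {N : ℕ} {T : ℕ → ℕ → ℕ} (hT : IsTableau g N T)
    (hf : Antitone f) (hgf : ∀ a, g a ≤ f a) (hfg : ∀ a, f (a + 1) ≤ g a) :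
    IsTableau f (N + 1) (extendFilling f g (N + 1) T) where
  bound {a b} h := by
    unfold _root_.extendFilling
    split_ifs with h1
    · have := hT.bound h1
      omega
    · omega
  zeros {a b} h := by
    have := hgf a
    unfold _root_.extendFilling
    rw [if_neg (by omega), if_neg (by omega)]
  row_weak {a b₁ b₂} h h2 := by
    unfold _root_.extendFilling
    by_cases h3 : b₂ < g a
    · rw [if_pos h3, if_pos (h.trans h3)]
      exact hT.row_weak h h3
    · rw [if_neg h3, if_pos h2, if_pos (h.trans h2)]
      split_ifs with h4
      · have := hT.bound h4
        omega
      · rfl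
  col_strict {a₁ a₂ b} h h2 := by
    have h4 : b < g a₁ := h2.trans_le ((hf h).trans (hfg a₁))
    unfold _root_.extendFilling
    rw [if_pos h4]
    split_ifs with h3
    · exact hT.col_strict h h3
    · have := hT.bound h4
      omega

theorem IsTableau.succ_le {f : ℕ → ℕ} {N : ℕ} {T : ℕ → ℕ → ℕ} (hT : IsTableau f N T)
    (hf : Antitone f) {a b : ℕ} (h : b < f a) : a + 1 ≤ T a b := by
  induction a with
  | zero => exact (hT.bound h).1
  | succ a ih =>
    have h1 := ih (h.trans_le (hf (Nat.le_succ a)))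
    exact (Nat.succ_le_succ h1).trans (hT.col_strict (Nat.lt_succ_self a) h)

theorem IsTableau.exists_eq_extendFilling {f : ℕ → ℕ} {N : ℕ} {T : ℕ → ℕ → ℕ}
    (hT : IsTableau f (N + 1) T) (hf : Antitone f) :
    ∃ g : ℕ → ℕ, (∀ a, g a ≤ f a) ∧ (∀ a, f (a + 1) ≤ g a) ∧ (∀ a, N ≤ a → g a = 0) ∧
      ∃ T', IsTableau g N T' ∧ T = _root_.extendFilling f g (N + 1) T' := by
  classical
  -- The inner row length is the first column that lies outside the row or holds the entry `N + 1`.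
  have hex : ∀ a, ∃ b, f a ≤ b ∨ N < T a b := fun a => ⟨f a, Or.inl le_rfl⟩
  have key : ∀ a b, b < Nat.find (hex a) ↔ b < f a ∧ T a b ≤ N := by
    intro a b
    rw [Nat.lt_find_iff]
    constructor
    · intro h
      have := h b le_rfl
      omega
    · rintro ⟨h1, h2⟩ b' hb'
      rcases hb'.eq_or_lt with rfl | hlt
      · omega
      · have := hT.row_weak hlt h1
        omega
  generalize hg : (fun a => Nat.find (hex a)) = g
  replace key : ∀ a b, b < g a ↔ b < f a ∧ T a b ≤ N := by
    intro a b
    rw [← hg]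
    exact key a b
  have hgf : ∀ a, g a ≤ f a := fun a => by
    by_contra! h
    exact absurd ((key _ _).1 h).1 (lt_irrefl _)
  refine ⟨g, hgf, fun a => ?_, fun a ha => ?_,
    fun a b => if b < g a then T a b else 0, ?_, ?_⟩
  · by_contra! h
    have h1 := hT.col_strict (Nat.lt_succ_self a) h
    have h2 := (hT.bound h).2
    have h3 := (key a (g a)).2 ⟨h.trans_le (hf (Nat.le_succ a)), by
      simp only [Nat.succ_eq_add_one] at h1
      omega⟩
    exact lt_irrefl _ h3
  · by_contra h
    have h1 := (key a 0).1 (by omega)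
    have := hT.succ_le hf h1.1
    omega
  · constructor
    · intro a b h
      simp only [if_pos h]
      exact ⟨(hT.bound ((key a b).1 h).1).1, ((key a b).1 h).2⟩
    · intro a b h
      simp only [if_neg h.not_gt]
    · intro a b₁ b₂ h h2
      simp only [if_pos h2, if_pos (h.trans h2)]
      exact hT.row_weak h ((key _ _).1 h2).1
    · intro a₁ a₂ b h h2
      have h3 := (key _ _).1 h2
      have h4 := hT.col_strict h h3.1
      have h5 := (key a₁ b).2 ⟨h3.1.trans_le (hf h.le), by omega⟩
      simp only [if_pos h2, if_pos h5]
      exact h4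
  · ext a b
    unfold _root_.extendFilling
    by_cases h : b < g a
    · simp only [if_pos h]
    · simp only [if_neg h]
      split_ifs with h1
      · have h2 := (hT.bound h1).2
        have h3 : ¬ T a b ≤ N := fun h3 => h ((key a b).2 ⟨h1, h3⟩)
        omega
      · exact hT.zeros (not_lt.1 h1)

theorem extendFilling_injective {f g g' : ℕ → ℕ} {N : ℕ} {T T' : ℕ → ℕ → ℕ}
    (hT : IsTableau g N T) (hT' : IsTableau g' N T')
    (h : extendFilling f g (N + 1) T = extendFilling f g' (N + 1) T') : g = g' ∧ T = T' := by
  have aux : ∀ {g : ℕ → ℕ} {T : ℕ → ℕ → ℕ}, IsTableau g N T → ∀ a b, b < g a ↔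
      1 ≤ extendFilling f g (N + 1) T a b ∧ extendFilling f g (N + 1) T a b ≤ N := by
    intro g T hT a b
    unfold extendFilling
    split_ifs with h1
    · simp [h1, hT.bound h1]
    · simp [h1]
    · simp [h1]
  have hg : g = g' := by
    ext a
    have h1 : ∀ b, b < g a ↔ b < g' a := fun b => by rw [aux hT, aux hT', h]
    have h2 := h1 (g a)
    have h3 := h1 (g' a)
    omega
  subst hg
  refine ⟨rfl, ?_⟩
  ext a b
  by_cases hb : b < g a
  · have h1 := congrFun (congrFun h a) b
    simpa [extendFilling, hb] using h1
  · rw [hT.zeros (not_lt.1 hb), hT'.zeros (not_lt.1 hb)]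

/-- The row lengths `a + m - c a` of the partition with (reversed, shifted) parts given by an
increasing sequence `c`. -/
def shapeOf (m : ℕ) {N : ℕ} (c : Fin N → ℕ) (a : ℕ) : ℕ :=
  if h : a < N then a + m - c ⟨a, h⟩ else 0

theorem antitone_shapeOf (m : ℕ) {N : ℕ} {c : Fin N → ℕ} (hc : StrictMono c) :
    Antitone (shapeOf m c) := by
  refine antitone_nat_of_succ_le fun a => ?_
  unfold shapeOf
  split_ifs with h1 h2
  · have := hc (show (⟨a, h2⟩ : Fin N) < ⟨a + 1, h1⟩ by simp)
    omega
  · omega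
  · omega
  · rfl

/-- Removing the entries `N + 1` leaves a shape given by some `z` with `c a ≤ z a < c (a + 1)`;
these inequalities are the horizontal strip condition, so the count obeys the branching rule of
`chooseDet`. The bound `hm` keeps the subtraction in `shapeOf` from truncating, so that shapes
determine sequences. -/
theorem finite_and_card_isTableau_shapeOf (m N : ℕ) (c : Fin N → ℕ) (hc : StrictMono c)
    (hm : ∀ a, c a ≤ a + m) :
    Finite {T // IsTableau (shapeOf m c) N T} ∧
      (Nat.card {T // IsTableau (shapeOf m c) N T} : ℝ) = chooseDet c := by
  induction N with
  | zero =>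
    have hz : ∀ a, shapeOf m c a = 0 := fun a => by simp [shapeOf]
    have : Unique {T // IsTableau (shapeOf m c) 0 T} :=
      { default := ⟨fun _ _ => 0, ⟨fun h => absurd h (by simp [hz]), fun _ => rfl,
          fun _ _ => le_rfl, fun _ h => absurd h (by simp [hz])⟩⟩
        uniq := fun T => by
          ext a b
          exact T.2.zeros (by simp [hz]) }
    refine ⟨inferInstance, ?_⟩
    simp [chooseDet]
  | succ N ih =>
    let P : Finset (Fin N → ℕ) :=
      Fintype.piFinset (fun a : Fin N => Finset.Ico (c a.castSucc) (c a.succ))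
    have hP : ∀ z ∈ P, ∀ a, c a.castSucc ≤ z a ∧ z a < c a.succ := fun z hz a => by
      simpa using Fintype.mem_piFinset.1 hz a
    have hPmono : ∀ z ∈ P, StrictMono z := fun z hz a b hab =>
      (hP z hz a).2.trans_le ((hc.monotone
        (show a.succ ≤ b.castSucc from Fin.le_def.2 (by simpa using hab))).trans (hP z hz b).1)
    have hPle : ∀ z ∈ P, ∀ a, z a ≤ a + m := fun z hz a => by
      have h1 := (hP z hz a).2
      have h2 := hm a.succ
      simp only [Fin.val_succ] at h2
      omega
    have hle : ∀ z ∈ P, ∀ a, shapeOf m z a ≤ shapeOf m c a := fun z hz a => by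
      unfold shapeOf
      split_ifs with h1 h2 <;> try omega
      have := (hP z hz ⟨a, h1⟩).1
      simp only [Fin.castSucc_mk] at this
      omega
    have hge : ∀ z ∈ P, ∀ a, shapeOf m c (a + 1) ≤ shapeOf m z a := fun z hz a => by
      unfold shapeOf
      split_ifs with h1 h2 <;> try omega
      have := (hP z hz ⟨a, h2⟩).2
      simp only [Fin.succ_mk] at this
      omega
    have hanti := antitone_shapeOf m hc
    let Φ : (Σ z : P, {T // IsTableau (shapeOf m z.1) N T}) →
        {T // IsTableau (shapeOf m c) (N + 1) T} := fun x =>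
      ⟨_, x.2.2.extendFilling hanti (hle x.1.1 x.1.2) (hge x.1.1 x.1.2)⟩
    have hΦ : Function.Bijective Φ := by
      constructor
      · rintro ⟨⟨z, hz⟩, T, hT⟩ ⟨⟨z', hz'⟩, T', hT'⟩ h
        obtain ⟨h1, rfl⟩ := extendFilling_injective hT hT' (congrArg Subtype.val h)
        have : z = z' := by
          ext a
          have h2 := congrFun h1 a
          simp only [shapeOf, a.2, dif_pos, Fin.eta] at h2
          have h3 := hPle z hz a
          have h4 := hPle z' hz' a
          omega
        subst this
        rfl
      · rintro ⟨T, hT⟩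
        obtain ⟨g, hgf, hfg, hg0, T', hT', rfl⟩ := hT.exists_eq_extendFilling hanti
        let z : Fin N → ℕ := fun a => a + m - g a
        have hb : ∀ a : Fin N, g a ≤ a + m ∧ c a.castSucc ≤ z a ∧ z a < c a.succ := fun a => by
          have h1 := hgf a
          have h2 := hfg a
          have h3 := hm a.castSucc
          have h4 := hm a.succ
          have h5 := hc a.castSucc_lt_succ
          have ha := a.2
          simp only [shapeOf, show (a : ℕ) < N + 1 by omega, dif_pos] at h1
          simp only [shapeOf, show (a : ℕ) + 1 < N + 1 by omega, dif_pos] at h2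
          change g a ≤ a + m - c a.castSucc at h1
          change a + 1 + m - c a.succ ≤ g a at h2
          simp only [Fin.val_succ, Fin.val_castSucc] at h3 h4
          simp only [z]
          omega
        have hz : z ∈ P := Fintype.mem_piFinset.2 fun a => Finset.mem_Ico.2 (hb a).2
        have hzg : shapeOf m z = g := by
          ext a
          unfold shapeOf
          split_ifs with h
          · have := (hb ⟨a, h⟩).1
            simp only [z] at this ⊢
            omega
          · exact (hg0 a (not_lt.1 h)).symm
        refine ⟨⟨⟨z, hz⟩, T', hzg.symm ▸ hT'⟩, Subtype.ext ?_⟩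
        change extendFilling (shapeOf m c) (shapeOf m z) (N + 1) T' = _
        rw [hzg]
    have hfin : ∀ z : P, Finite {T // IsTableau (shapeOf m z.1) N T} := fun z =>
      (ih z.1 (hPmono z.1 z.2) (hPle z.1 z.2)).1
    refine ⟨Finite.of_surjective Φ hΦ.2, ?_⟩
    rw [← Nat.card_congr (Equiv.ofBijective Φ hΦ), Nat.card_sigma, Nat.cast_sum,
      ← sum_chooseDet_interlacing c hc.monotone, ← Finset.sum_coe_sort P]
    exact Finset.sum_congr rfl fun z _ => (ih z.1 (hPmono z.1 z.2) (hPle z.1 z.2)).2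

/-! ### Ranks and difference products for subsets of `Fin n` -/

theorem Finset.filter_lt_eq_map_orderEmbOfFin {n k : ℕ} (S : Finset (Fin n)) (h : S.card = k)
    (y : Fin n) : S.filter (· < y) =
      (Finset.univ.filter fun p => S.orderEmbOfFin h p < y).map
        (S.orderEmbOfFin h).toEmbedding := by
  conv_lhs => rw [← S.map_orderEmbOfFin_univ h]
  rw [Finset.filter_map]
  rfl

theorem Finset.succ_le_card_filter_lt_iff {n k : ℕ} (S : Finset (Fin n)) (h : S.card = k)
    (y : Fin n) (a : Fin k) :
    (a : ℕ) + 1 ≤ (S.filter (· < y)).card ↔ S.orderEmbOfFin h a < y := by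
  rw [S.filter_lt_eq_map_orderEmbOfFin h, Finset.card_map]
  constructor
  · intro h2
    by_contra h3
    have h4 : (Finset.univ.filter fun p => S.orderEmbOfFin h p < y) ⊆ Finset.Iio a := by
      intro p hp
      rw [Finset.mem_filter] at hp
      rw [Finset.mem_Iio]
      by_contra h5
      exact h3 (((S.orderEmbOfFin h).monotone (not_lt.1 h5)).trans_lt hp.2)
    have h5 := Finset.card_le_card h4
    rw [Fin.card_Iio] at h5
    omega
  · intro h2
    have h4 : Finset.Iic a ⊆ (Finset.univ.filter fun p => S.orderEmbOfFin h p < y) := by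
      intro p hp
      rw [Finset.mem_Iic] at hp
      rw [Finset.mem_filter]
      exact ⟨Finset.mem_univ _, ((S.orderEmbOfFin h).monotone hp).trans_lt h2⟩
    have h5 := Finset.card_le_card h4
    rwa [Fin.card_Iic] at h5

theorem Finset.card_filter_lt_orderEmbOfFin {n k : ℕ} (S : Finset (Fin n)) (h : S.card = k)
    (a : Fin k) : (S.filter (· < S.orderEmbOfFin h a)).card = a := by
  rw [S.filter_lt_eq_map_orderEmbOfFin h, Finset.card_map, ← Fin.card_Iio a]
  congr 1
  ext p
  simp

theorem Finset.card_filter_lt_add_card_compl_filter_lt {n : ℕ} (S : Finset (Fin n)) (y : Fin n) :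
    (S.filter (· < y)).card + (Sᶜ.filter (· < y)).card = y := by
  rw [← Finset.card_union_of_disjoint, ← Finset.filter_union, Finset.union_compl]
  · rw [← Fin.card_Iio y]
    congr 1
    ext
    simp
  · exact Finset.disjoint_filter_filter disjoint_compl_right

/-- The product of the differences `y - x` over `x ∈ S` and `y ∈ T` with `x < y`. -/
noncomputable def diffProd {n : ℕ} (S T : Finset (Fin n)) : ℝ :=
  ∏ x ∈ S, ∏ y ∈ T, if x < y then (((y : ℕ) : ℝ) - ((x : ℕ) : ℝ)) else 1

theorem diffProd_ne_zero {n : ℕ} (S T : Finset (Fin n)) : diffProd S T ≠ 0 := by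
  refine Finset.prod_ne_zero_iff.2 fun x _ => Finset.prod_ne_zero_iff.2 fun y _ => ?_
  split_ifs with h
  · have : (x : ℕ) < y := h
    exact sub_ne_zero.2 (by exact_mod_cast this.ne')
  · exact one_ne_zero

theorem diffProd_mul_compl_left {n : ℕ} (S T : Finset (Fin n)) :
    diffProd S T * diffProd Sᶜ T = diffProd Finset.univ T :=
  Finset.prod_mul_prod_compl S _

theorem diffProd_mul_compl_right {n : ℕ} (S T : Finset (Fin n)) :
    diffProd S T * diffProd S Tᶜ = diffProd S Finset.univ := by
  unfold diffProd
  rw [← Finset.prod_mul_distrib]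
  exact Finset.prod_congr rfl fun x _ => Finset.prod_mul_prod_compl T _

theorem vandermonde_orderEmbOfFin {n k : ℕ} (S : Finset (Fin n)) (h : S.card = k) :
    (Matrix.vandermonde fun a => (((S.orderEmbOfFin h a : Fin n) : ℕ) : ℝ)).det = diffProd S S := by
  rw [Matrix.det_vandermonde]
  unfold diffProd
  conv_rhs => rw [← S.map_orderEmbOfFin_univ h]
  rw [Finset.prod_map]
  refine Finset.prod_congr rfl fun a _ => ?_
  rw [Finset.prod_map, ← Finset.filter_lt_eq_Ioi, Finset.prod_filter]
  refine Finset.prod_congr rfl fun b _ => ?_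
  simp

/-- The number `x! (n-1-x)!` is the product of the distances from `x` to all other points. Over `S`,
pairs inside `S` thus occur twice and pairs meeting both `S` and its complement once. -/
theorem prod_factorial_mul_diffProd_compl {n : ℕ} (S : Finset (Fin n)) :
    (∏ x ∈ S, (((x : ℕ).factorial : ℝ) * ((n - 1 - (x : ℕ)).factorial : ℝ))) * diffProd Sᶜ Sᶜ =
      diffProd S S * diffProd (Finset.univ : Finset (Fin n)) Finset.univ := by
  have h1 : ∏ x ∈ S, ((x : ℕ).factorial : ℝ) = diffProd Finset.univ S := by
    unfold diffProd
    rw [Finset.prod_comm]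
    refine Finset.prod_congr rfl fun x _ => ?_
    simp only [Fin.lt_def]
    rw [Fin.prod_univ_eq_prod_range
      (fun y => if y < (x : ℕ) then (((x : ℕ) : ℝ) - (y : ℝ)) else 1) n,
      ← Finset.prod_filter]
    have : (Finset.range n).filter (· < (x : ℕ)) = Finset.range x := by
      ext y
      have := x.2
      simp only [Finset.mem_filter, Finset.mem_range]
      omega
    rw [this, ← Finset.prod_range_reflect, ← Finset.prod_range_add_one_eq_factorial, Nat.cast_prod]
    refine Finset.prod_congr rfl fun y hy => ?_
    rw [Finset.mem_range] at hy
    rw [Nat.sub_sub, Nat.cast_sub (by omega)]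
    push_cast
    ring
  have h2 : ∏ x ∈ S, ((n - 1 - (x : ℕ)).factorial : ℝ) = diffProd S Finset.univ := by
    unfold diffProd
    refine Finset.prod_congr rfl fun x _ => ?_
    simp only [Fin.lt_def]
    rw [Fin.prod_univ_eq_prod_range
      (fun y => if (x : ℕ) < y then ((y : ℝ) - ((x : ℕ) : ℝ)) else 1) n,
      ← Finset.prod_filter]
    have : (Finset.range n).filter ((x : ℕ) < ·) = Finset.Ico (x + 1 : ℕ) n := by
      ext y
      simp only [Finset.mem_filter, Finset.mem_range, Finset.mem_Ico]
      omega
    rw [this, Finset.prod_Ico_eq_prod_range, ← Finset.prod_range_add_one_eq_factorial,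
      Nat.cast_prod, show n - 1 - (x : ℕ) = n - (x + 1 : ℕ) by omega]
    refine Finset.prod_congr rfl fun y _ => ?_
    push_cast
    ring
  rw [Finset.prod_mul_distrib, h1, h2, ← diffProd_mul_compl_left S Finset.univ,
    ← diffProd_mul_compl_left S S, ← diffProd_mul_compl_right S S,
    ← diffProd_mul_compl_right Sᶜ S]
  ring

/-! ### The conjugate partition and the complement of `J` -/

namespace SubsetsOf

variable {n m : ℕ}

theorem le_of_subset (J : SubsetsOf n m) : m ≤ n := by
  have := J.1.card_le_univ
  rwa [J.2, Fintype.card_fin] at this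

theorem card_compl (J : SubsetsOf n m) : (J.1ᶜ).card = n - m := by
  rw [Finset.card_compl, Fintype.card_fin, J.2]

/-- The increasing enumeration of the complement. -/
def complEnum (J : SubsetsOf n m) (a : Fin (n - m)) : ℕ := J.1ᶜ.orderEmbOfFin J.card_compl a

theorem complEnum_strictMono (J : SubsetsOf n m) : StrictMono J.complEnum := fun _ _ h =>
  (J.1ᶜ.orderEmbOfFin J.card_compl).strictMono h

theorem card_compl_filter_lt (J : SubsetsOf n m) (k : Fin m) :
    (J.1ᶜ.filter (· < J.1.orderEmbOfFin J.2 k.rev)).card = J.part k := by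
  have h1 := J.1.card_filter_lt_add_card_compl_filter_lt (J.1.orderEmbOfFin J.2 k.rev)
  rw [J.1.card_filter_lt_orderEmbOfFin] at h1
  unfold part
  omega

theorem val_le_orderEmbOfFin (J : SubsetsOf n m) (p : Fin m) :
    (p : ℕ) ≤ J.1.orderEmbOfFin J.2 p := by
  have h1 := J.1.card_filter_lt_add_card_compl_filter_lt (J.1.orderEmbOfFin J.2 p)
  rw [J.1.card_filter_lt_orderEmbOfFin] at h1
  omega

theorem part_le (J : SubsetsOf n m) (k : Fin m) : J.part k ≤ n - m := by
  rw [← J.card_compl_filter_lt k, ← J.card_compl]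
  exact Finset.card_filter_le _ _

theorem size_le (J : SubsetsOf n m) : J.size ≤ m * (n - m) := by
  refine (Finset.sum_le_sum fun k _ => J.part_le k).trans ?_
  simp

/-- If `y` is the complement element of rank `a`, then `λ'_a` counts the elements of `J` above `y`,
while `y - a` elements of `J` lie below it. -/
theorem conjPart_add_complEnum (J : SubsetsOf n m) (a : Fin (n - m)) :
    J.conjPart a + J.complEnum a = a + m := by
  set y := J.1ᶜ.orderEmbOfFin J.card_compl a with hy
  have hyJ : y ∉ J.1 := Finset.mem_compl.1 (J.1ᶜ.orderEmbOfFin_mem J.card_compl a)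
  have h1 := J.1.card_filter_lt_add_card_compl_filter_lt y
  rw [hy, J.1ᶜ.card_filter_lt_orderEmbOfFin, ← hy] at h1
  have h2 : J.conjPart a = (J.1.filter (y < ·)).card := by
    unfold conjPart
    conv_rhs => rw [← J.1.map_orderEmbOfFin_univ J.2]
    rw [Finset.filter_map, Finset.card_map, ← Finset.card_map Fin.revPerm.toEmbedding]
    congr 1
    ext p
    simp only [Finset.mem_map_equiv, Finset.mem_filter, Finset.mem_univ, true_and]
    rw [← card_compl_filter_lt, Finset.succ_le_card_filter_lt_iff _ J.card_compl, ← hy]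
    simp
  have h3 : (J.1.filter (· < y)).card + (J.1.filter (y < ·)).card = m := by
    rw [← Finset.card_union_of_disjoint, ← Finset.filter_or]
    · conv_rhs => rw [← J.2]
      rw [Finset.filter_true_of_mem]
      intro x hx
      exact lt_or_gt_of_ne fun h => hyJ (h ▸ hx)
    · exact Finset.disjoint_filter.2 fun x _ h => h.not_gt
  have h4 : J.complEnum a = y := rfl
  omega

theorem weylNumber_eq_chooseDet (J : SubsetsOf n m) : J.weylNumber = chooseDet J.complEnum := by
  rw [chooseDet_eq_prod]
  refine Finset.prod_congr rfl fun a _ => Finset.prod_congr rfl fun b _ => ?_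
  have ha : (J.conjPart a : ℝ) + J.complEnum a = (a : ℕ) + m := by
    exact_mod_cast J.conjPart_add_complEnum a
  have hb : (J.conjPart b : ℝ) + J.complEnum b = (b : ℕ) + m := by
    exact_mod_cast J.conjPart_add_complEnum b
  congr 1
  linear_combination ha - hb

theorem mem_conjDiagram (J : SubsetsOf n m) (a b : ℕ) :
    (a, b) ∈ J.conjDiagram ↔ b < shapeOf m J.complEnum a := by
  unfold conjDiagram shapeOf
  rw [YoungDiagram.mem_ofRowLens]
  simp only [List.length_ofFn, List.getElem_ofFn]
  split_ifs with h
  · have := J.conjPart_add_complEnum ⟨a, h⟩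
    simp only at this
    rw [show a + m - J.complEnum ⟨a, h⟩ = J.conjPart ⟨a, h⟩ by omega]
    exact ⟨fun h => h.2, fun h' => ⟨h, h'⟩⟩
  · exact ⟨fun h' => absurd h'.1 h, fun h' => absurd h' (Nat.not_lt_zero _)⟩

/-- Semistandard tableaux of shape `λ'(J)` as fillings of rows of given lengths. -/
def tableauEquiv (J : SubsetsOf n m) (N : ℕ) :
    BoundedSSYT J.conjDiagram N ≃ {T // IsTableau (shapeOf m J.complEnum) N T} where
  toFun T := ⟨T.1,
    { bound := fun h => T.2 _ _ ((J.mem_conjDiagram _ _).2 h)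
      zeros := fun h => T.1.zeros fun h' => h.not_gt ((J.mem_conjDiagram _ _).1 h')
      row_weak := fun h h' => T.1.row_weak h ((J.mem_conjDiagram _ _).2 h')
      col_strict := fun h h' => T.1.col_strict h ((J.mem_conjDiagram _ _).2 h') }⟩
  invFun T := ⟨
    { entry := T.1
      row_weak' := fun h h' => T.2.row_weak h ((J.mem_conjDiagram _ _).1 h')
      col_strict' := fun h h' => T.2.col_strict h ((J.mem_conjDiagram _ _).1 h')
      zeros' := fun h => T.2.zeros (not_lt.1 fun h' => h ((J.mem_conjDiagram _ _).2 h')) },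
    fun _ _ h => T.2.bound ((J.mem_conjDiagram _ _).1 h)⟩
  left_inv _ := rfl
  right_inv _ := rfl

theorem weylNumber_eq_card (J : SubsetsOf n m) :
    J.weylNumber = (Nat.card (BoundedSSYT J.conjDiagram (n - m)) : ℝ) := by
  rw [weylNumber_eq_chooseDet, Nat.card_congr (J.tableauEquiv (n - m))]
  refine (finite_and_card_isTableau_shapeOf m (n - m) J.complEnum J.complEnum_strictMono
    fun a => ?_).2.symm
  have := J.conjPart_add_complEnum a
  omega

end SubsetsOf

/-! ### The determinant of shifted binomial coefficients -/

theorem Nat.choose_sub_mul_factorial_mul_factorial {n m j q : ℕ} (hmn : m ≤ n) (hj : j < n)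
    (hq : q < m) :
    (if q ≤ j then (n - m).choose (j - q) else 0) * (j.factorial * (n - 1 - j).factorial) =
      (n - m).factorial * (j.descFactorial q * (n - 1 - j).descFactorial (m - 1 - q)) := by
  split_ifs with h1
  · by_cases h2 : j - q ≤ n - m
    · have h3 := Nat.factorial_mul_descFactorial h1
      have h4 := Nat.factorial_mul_descFactorial (show m - 1 - q ≤ n - 1 - j by omega)
      have h5 := Nat.choose_mul_factorial_mul_factorial h2
      rw [show n - 1 - j - (m - 1 - q) = n - m - (j - q) by omega] at h4
      rw [← h3, ← h4, ← h5]
      ring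
    · rw [Nat.choose_eq_zero_of_lt (by omega),
        Nat.descFactorial_of_lt (show n - 1 - j < m - 1 - q by omega)]
      simp
  · rw [Nat.descFactorial_of_lt (by omega)]
    simp

namespace SubsetsOf

variable {n m : ℕ}

/-- The determinant of the binomial coefficients `binom(n - m, j_p - q)`. -/
noncomputable def binomDet (J : SubsetsOf n m) : ℝ :=
  (Matrix.of fun p q : Fin m => ((if (q : ℕ) ≤ J.1.orderEmbOfFin J.2 p then
    (n - m).choose ((J.1.orderEmbOfFin J.2 p : ℕ) - q) else 0 : ℕ) : ℝ)).det

/-- Scaling row `p` by `j_p! (n-1-j_p)!` turns its entries into values at `j_p` of polynomials of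
degree less than `m`, which gives the Vandermonde product of `J`. The scaling factors convert it
into that of the complement. -/
theorem exists_binomDet_eq (n m : ℕ) :
    ∃ K : ℝ, ∀ J : SubsetsOf n m, J.binomDet = K * diffProd J.1ᶜ J.1ᶜ := by
  let f : Fin m → Polynomial ℝ := fun q =>
    descPochhammer ℝ q * (descPochhammer ℝ (m - 1 - q)).comp
      (Polynomial.C ((n - 1 : ℕ) : ℝ) - Polynomial.X)
  have hf : ∀ q, (f q).natDegree < m := fun q => by
    have h1 : (Polynomial.C ((n - 1 : ℕ) : ℝ) - Polynomial.X).natDegree ≤ 1 :=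
      (Polynomial.natDegree_sub_le _ _).trans (by simp)
    have h2 : (f q).natDegree ≤ q + (m - 1 - q) * 1 := by
      refine Polynomial.natDegree_mul_le.trans (add_le_add ?_ ?_)
      · rw [descPochhammer_natDegree]
      · refine Polynomial.natDegree_comp_le.trans ?_
        rw [descPochhammer_natDegree]
        exact Nat.mul_le_mul_left _ h1
    have := q.2
    omega
  refine ⟨((n - m).factorial : ℝ) ^ m * (Matrix.of fun r q : Fin m => (f q).coeff r).det /
    diffProd (Finset.univ : Finset (Fin n)) Finset.univ, fun J => ?_⟩
  set j : Fin m → Fin n := fun p => J.1.orderEmbOfFin J.2 p with hj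
  have h1 : (∏ x ∈ J.1, (((x : ℕ).factorial : ℝ) * ((n - 1 - (x : ℕ)).factorial : ℝ))) *
      J.binomDet = ((n - m).factorial : ℝ) ^ m *
        ((Matrix.of fun r q : Fin m => (f q).coeff r).det * diffProd J.1 J.1) := by
    rw [← vandermonde_orderEmbOfFin J.1 J.2, ← det_eval_eq_mul_vandermonde f hf]
    conv_lhs =>
      enter [1]
      rw [← J.1.map_orderEmbOfFin_univ J.2]
    rw [Finset.prod_map]
    unfold binomDet
    rw [← Matrix.det_mul_column]
    rw [show ((n - m).factorial : ℝ) ^ m = ((n - m).factorial : ℝ) ^ Fintype.card (Fin m) by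
      rw [Fintype.card_fin], ← Matrix.det_smul]
    congr 1
    ext p q
    have h2 := Nat.choose_sub_mul_factorial_mul_factorial J.le_of_subset (j p).2 q.2
    have h3 : (((n - 1 - (j p : ℕ) : ℕ)) : ℝ) = ((n - 1 : ℕ) : ℝ) - ((j p : ℕ) : ℝ) :=
      Nat.cast_sub (by have := (j p).2; omega)
    simp only [Matrix.of_apply, Matrix.smul_apply, smul_eq_mul, f, Polynomial.eval_mul,
      Polynomial.eval_comp, Polynomial.eval_sub, Polynomial.eval_C, Polynomial.eval_X]
    change _ = ((n - m).factorial : ℝ) * ((descPochhammer ℝ q).eval ((j p : ℕ) : ℝ) *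
      (descPochhammer ℝ (m - 1 - q)).eval (((n - 1 : ℕ) : ℝ) - ((j p : ℕ) : ℝ)))
    rw [← h3, descPochhammer_eval_eq_descFactorial, descPochhammer_eval_eq_descFactorial, mul_comm]
    exact_mod_cast h2
  have h2 := prod_factorial_mul_diffProd_compl J.1
  have h3 := diffProd_ne_zero J.1 J.1
  have h4 := diffProd_ne_zero (Finset.univ : Finset (Fin n)) Finset.univ
  rw [div_mul_eq_mul_div, eq_div_iff h4]
  refine mul_left_cancel₀ h3 ?_
  linear_combination (-J.binomDet) * h2 + diffProd J.1ᶜ J.1ᶜ * h1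

theorem exists_weylNumber_eq (n m : ℕ) :
    ∃ K : ℝ, ∀ J : SubsetsOf n m, J.weylNumber = K * diffProd J.1ᶜ J.1ᶜ := by
  obtain ⟨K, hK⟩ := exists_chooseDet_eq_mul_vandermonde (n - m)
  refine ⟨K, fun J => ?_⟩
  rw [weylNumber_eq_chooseDet, hK, ← vandermonde_orderEmbOfFin J.1ᶜ J.card_compl]
  rfl

theorem exists_orderEmbOfFin_eq_val (h : m ≤ n) :
    ∃ J : SubsetsOf n m, ∀ p, ((J.1.orderEmbOfFin J.2 p : Fin n) : ℕ) = p := by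
  refine ⟨⟨Finset.univ.map (Fin.castLEEmb h), by simp⟩, fun p => ?_⟩
  rw [← Finset.orderEmbOfFin_unique (f := Fin.castLE h) _ (fun x => by simp)
    (Fin.strictMono_castLE h)]
  rfl

theorem binomDet_eq_weylNumber (J : SubsetsOf n m) : J.binomDet = J.weylNumber := by
  obtain ⟨K₁, h₁⟩ := exists_binomDet_eq n m
  obtain ⟨K₂, h₂⟩ := exists_weylNumber_eq n m
  obtain ⟨I, hI⟩ := exists_orderEmbOfFin_eq_val J.le_of_subset
  have hb : I.binomDet = 1 := by
    unfold binomDet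
    rw [Matrix.det_of_isLowerTriangular]
    · simp [hI]
    · intro p q hpq
      have : ¬ (q : ℕ) ≤ p := not_le.2 (by simpa using hpq)
      simp only [Matrix.of_apply, hI, if_neg this, Nat.cast_zero]
  have hw : I.weylNumber = 1 := by
    have hc : ∀ k, I.conjPart k = 0 := fun k => by simp [conjPart, part, hI]
    unfold weylNumber
    refine Finset.prod_eq_one fun a _ => Finset.prod_eq_one fun b hb => ?_
    rw [Finset.mem_Ioi] at hb
    have hab : ((b : ℕ) : ℝ) - ((a : ℕ) : ℝ) ≠ 0 :=
      sub_ne_zero.2 (by exact_mod_cast (show (a : ℕ) < b from hb).ne')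
    rw [hc, hc]
    field_simp
    simp
    ring
  have hK : K₁ = K₂ := by
    refine mul_right_cancel₀ (diffProd_ne_zero I.1ᶜ I.1ᶜ) ?_
    rw [← h₁, ← h₂, hb, hw]
  rw [h₁, h₂, hK]

end SubsetsOf

/-! ### Cauchy–Binet -/

theorem exists_subset_perm_of_injective {n m : ℕ} {g : Fin m → Fin n}
    (hg : Function.Injective g) :
    ∃ (J : SubsetsOf n m) (σ : Equiv.Perm (Fin m)), g = fun p => J.1.orderEmbOfFin J.2 (σ p) := by
  have hcard : (Finset.univ.map ⟨g, hg⟩).card = m := by simp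
  let J : SubsetsOf n m := ⟨Finset.univ.map ⟨g, hg⟩, hcard⟩
  let e : Fin m → Fin m := fun p => (J.1.orderIsoOfFin J.2).symm ⟨g p, by simp [J]⟩
  have he : ∀ p, J.1.orderEmbOfFin J.2 (e p) = g p := fun p => by
    rw [← Finset.coe_orderIsoOfFin_apply, OrderIso.apply_symm_apply]
  have hinj : Function.Injective e := fun p q h => hg (by rw [← he, ← he, h])
  exact ⟨J, Equiv.ofBijective e (Finite.injective_iff_bijective.1 hinj), funext fun p => (he p).symm⟩

/-- The Cauchy–Binet formula. -/
theorem Matrix.det_mul_eq_sum_minors {R : Type*} [CommRing R] {n m : ℕ}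
    (A : Matrix (Fin m) (Fin n) R) (B : Matrix (Fin n) (Fin m) R) :
    (A * B).det = ∑ J : SubsetsOf n m,
      (A.submatrix id (J.1.orderEmbOfFin J.2)).det *
        (B.submatrix (J.1.orderEmbOfFin J.2) id).det := by
  classical
  have h1 : (A * B).det = ∑ g : Fin m → Fin n, (∏ p, A p (g p)) * (B.submatrix g id).det := by
    have h2 := (Matrix.detRowAlternating (R := R) (n := Fin m)).toMultilinearMap.map_sum
      (fun p (k : Fin n) => A p k • B k)
    have h3 : (A * B).det = Matrix.detRowAlternating (fun p => ∑ k, A p k • B k) := by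
      refine congrArg Matrix.det ?_
      ext p q
      simp [Matrix.mul_apply, Finset.sum_apply]
    refine h3.trans (h2.trans (Finset.sum_congr rfl fun g _ => ?_))
    refine (MultilinearMap.map_smul_univ _ _ _).trans ?_
    rfl
  -- Injective maps `g` are pairs of an image and an ordering of it; the other `g` repeat a row of
  -- `B` and contribute zero.
  let Ψ : SubsetsOf n m × Equiv.Perm (Fin m) → (Fin m → Fin n) := fun x p =>
    x.1.1.orderEmbOfFin x.1.2 (x.2 p)
  have hΨ : Function.Injective Ψ := by
    rintro ⟨J, σ⟩ ⟨J', σ'⟩ h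
    have hr : ∀ (J : SubsetsOf n m) (σ : Equiv.Perm (Fin m)), Set.range (Ψ (J, σ)) = J.1 := by
      intro J σ
      rw [← J.1.range_orderEmbOfFin J.2]
      exact σ.surjective.range_comp _
    have hJ : J = J' := Subtype.ext (Finset.coe_injective (by rw [← hr J σ, h, hr]))
    subst hJ
    have : σ = σ' := Equiv.ext fun p => (J.1.orderEmbOfFin J.2).injective (congrFun h p)
    rw [this]
  rw [h1, ← Finset.sum_subset (Finset.subset_univ (Finset.univ.map ⟨Ψ, hΨ⟩)), Finset.sum_map,
    Fintype.sum_prod_type]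
  · refine Finset.sum_congr rfl fun J _ => ?_
    rw [← Matrix.det_transpose (A.submatrix id _), Matrix.det_apply', Finset.sum_mul]
    refine Finset.sum_congr rfl fun σ _ => ?_
    have h4 : (B.submatrix (Ψ (J, σ)) id).det =
        ((Equiv.Perm.sign σ : ℤ) : R) * (B.submatrix (J.1.orderEmbOfFin J.2) id).det := by
      rw [← Matrix.det_permute]
      rfl
    change _ * (B.submatrix (Ψ (J, σ)) id).det = _
    rw [h4]
    simp only [Matrix.transpose_apply, Matrix.submatrix_apply, id]
    change (∏ p, A p (J.1.orderEmbOfFin J.2 (σ p))) * _ = _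
    ring
  · intro g _ hg
    have hgi : ¬ Function.Injective g := fun h => by
      obtain ⟨J, σ, h⟩ := exists_subset_perm_of_injective h
      exact hg (Finset.mem_map.2 ⟨(J, σ), Finset.mem_univ _, h.symm⟩)
    simp only [Function.Injective, not_forall] at hgi
    obtain ⟨p, q, hpq, hne⟩ := hgi
    rw [Matrix.det_zero_of_row_eq hne, mul_zero]
    ext k
    simp [hpq]

/-! ### Derivatives of a binary form and the factorization of the Hessian matrix -/

theorem MvPolynomial.IsHomogeneous.eq_sum_fin_two {d : ℕ} {F : BiPoly} (hF : F.IsHomogeneous d) :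
    F = ∑ k ∈ Finset.range (d + 1),
      C (coeff (Finsupp.single 0 k + Finsupp.single 1 (d - k)) F) * X 0 ^ k * X 1 ^ (d - k) := by
  let u : ℕ → (Fin 2 →₀ ℕ) := fun k => Finsupp.single 0 k + Finsupp.single 1 (d - k)
  have hu : Function.Injective u := fun k l h => by
    have := DFunLike.congr_fun h 0
    simpa [u] using this
  have h1 : F.support ⊆ (Finset.range (d + 1)).image u := by
    intro v hv
    have h2 := hF (mem_support_iff.1 hv)
    rw [Finsupp.weight_apply, Finsupp.sum_fintype _ _ (by simp), Fin.sum_univ_two] at h2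
    simp only [Pi.one_apply, smul_eq_mul, mul_one] at h2
    refine Finset.mem_image.2 ⟨v 0, Finset.mem_range.2 (by omega), ?_⟩
    ext t
    fin_cases t
    · simp [u]
    · simp [u]
      omega
  conv_lhs => rw [F.as_sum]
  rw [Finset.sum_subset h1 fun v _ hv => by rw [notMem_support_iff.1 hv, monomial_zero],
    Finset.sum_image fun _ _ _ _ h => hu h]
  refine Finset.sum_congr rfl fun k _ => ?_
  rw [monomial_eq, Finsupp.prod_fintype _ _ (by simp), Fin.prod_univ_two]
  simp [u, mul_assoc]

theorem pderiv_zero_iterate_term (t : ℕ) (c : ℝ) (a b : ℕ) :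
    (pderiv 0)^[t] (C c * X 0 ^ a * X 1 ^ b : BiPoly) =
      C (c * (a.descFactorial t : ℝ)) * X 0 ^ (a - t) * X 1 ^ b := by
  induction t with
  | zero => simp
  | succ t ih =>
    rw [Function.iterate_succ_apply', ih, mul_assoc, pderiv_C_mul, pderiv_mul, pderiv_pow,
      pderiv_pow, Nat.descFactorial_succ]
    simp only [pderiv_X_self, ne_eq, one_ne_zero, not_false_eq_true, pderiv_X_of_ne, mul_zero,
      mul_one, add_zero, Nat.cast_mul, C_mul, map_natCast, Nat.sub_sub]
    ring

theorem pderiv_one_iterate_term (t : ℕ) (c : ℝ) (a b : ℕ) :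
    (pderiv 1)^[t] (C c * X 0 ^ a * X 1 ^ b : BiPoly) =
      C (c * (b.descFactorial t : ℝ)) * X 0 ^ a * X 1 ^ (b - t) := by
  induction t with
  | zero => simp
  | succ t ih =>
    rw [Function.iterate_succ_apply', ih, mul_assoc, pderiv_C_mul, pderiv_mul, pderiv_pow,
      pderiv_pow, Nat.descFactorial_succ]
    simp only [pderiv_X_self, ne_eq, zero_ne_one, not_false_eq_true, pderiv_X_of_ne, mul_zero,
      mul_one, zero_mul, zero_add, Nat.cast_mul, C_mul, map_natCast, Nat.sub_sub]
    ring

theorem pderiv_iterate_sum {ι : Type*} (j : Fin 2) (t : ℕ) (s : Finset ι) (f : ι → BiPoly) :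
    (pderiv j)^[t] (∑ k ∈ s, f k) = ∑ k ∈ s, (pderiv j)^[t] (f k) := by
  induction t with
  | zero => rfl
  | succ t ih => simp only [Function.iterate_succ_apply', ih, map_sum]

theorem Nat.choose_mul_descFactorial_mul_descFactorial {d s t k : ℕ} (hs : s ≤ d) (ht : t ≤ s)
    (hk : k ≤ d) :
    d.choose k * (d - k).descFactorial (s - t) * k.descFactorial t * (d - s).factorial =
      d.factorial * (if t ≤ k then (d - s).choose (k - t) else 0) := by
  split_ifs with h1
  · by_cases h2 : k - t ≤ d - s
    · rw [← Nat.choose_mul_factorial_mul_factorial h2, ← Nat.choose_mul_factorial_mul_factorial hk,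
        ← Nat.factorial_mul_descFactorial h1,
        ← Nat.factorial_mul_descFactorial (show s - t ≤ d - k by omega),
        show d - k - (s - t) = d - s - (k - t) by omega]
      ring
    · rw [Nat.choose_eq_zero_of_lt (show d - s < k - t by omega),
        Nat.descFactorial_of_lt (show d - k < s - t by omega)]
      simp
  · rw [Nat.descFactorial_of_lt (show k < t by omega)]
    simp

theorem pderiv_iterate_form {d s t : ℕ} (hs : s ≤ d) (ht : t ≤ s) {F : BiPoly}
    (hF : F.IsHomogeneous d) :
    (pderiv 0)^[t] ((pderiv 1)^[s - t] F) =
      C ((d.factorial : ℝ) / ((d - s).factorial : ℝ)) *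
        ∑ k ∈ Finset.range (d + 1),
          C (normCoeff d F k) * (C ((if t ≤ k then (d - s).choose (k - t) else 0 : ℕ) : ℝ) *
            X 0 ^ (k - t) * X 1 ^ (d - s - (k - t))) := by
  conv_lhs => rw [hF.eq_sum_fin_two]
  rw [pderiv_iterate_sum, pderiv_iterate_sum, Finset.mul_sum]
  refine Finset.sum_congr rfl fun k hk => ?_
  rw [pderiv_one_iterate_term, pderiv_zero_iterate_term]
  have hk' : k ≤ d := Nat.lt_succ_iff.1 (Finset.mem_range.1 hk)
  have h1 := Nat.choose_mul_descFactorial_mul_descFactorial hs ht hk'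
  have h2 : ((d.choose k : ℝ) * (d - k).descFactorial (s - t) * k.descFactorial t) *
      (d - s).factorial =
      d.factorial * ((if t ≤ k then (d - s).choose (k - t) else 0 : ℕ) : ℝ) := by exact_mod_cast h1
  have h3 : ((d - s).factorial : ℝ) ≠ 0 := by exact_mod_cast (d - s).factorial_ne_zero
  have h4 : (d.choose k : ℝ) ≠ 0 := by exact_mod_cast (Nat.choose_pos hk').ne'
  have h5 : coeff (Finsupp.single 0 k + Finsupp.single 1 (d - k)) F *
      ((d - k).descFactorial (s - t) : ℝ) * (k.descFactorial t : ℝ) =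
      (d.factorial : ℝ) / ((d - s).factorial : ℝ) * normCoeff d F k *
        ((if t ≤ k then (d - s).choose (k - t) else 0 : ℕ) : ℝ) := by
    unfold normCoeff
    rw [div_mul_div_comm, div_mul_eq_mul_div, eq_div_iff (mul_ne_zero h3 h4)]
    linear_combination (coeff (Finsupp.single 0 k + Finsupp.single 1 (d - k)) F) * h2
  rw [h5]
  -- Outside this range the truncated exponents on the two sides may differ, but the coefficient
  -- vanishes.
  by_cases h6 : t ≤ k ∧ k - t ≤ d - s
  · rw [show d - k - (s - t) = d - s - (k - t) by omega]
    simp only [C_mul]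
    ring
  · have h7 : (if t ≤ k then (d - s).choose (k - t) else 0) = 0 := by
      split_ifs with h8
      · exact Nat.choose_eq_zero_of_lt (by omega)
      · rfl
    simp [h7]

/-- Every pair is an inversion, and `n(n-1)/2` has the parity of `⌊n/2⌋`. -/
theorem sign_revPerm (n : ℕ) : Equiv.Perm.sign (Fin.revPerm : Equiv.Perm (Fin n)) = (-1) ^ (n / 2) := by
  have h1 : Equiv.Perm.sign (Fin.revPerm : Equiv.Perm (Fin n)) =
      ∏ j : Fin n, (-1 : ℤˣ) ^ (j : ℕ) := by
    rw [Equiv.Perm.sign_eq_prod_prod_Iio]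
    refine Finset.prod_congr rfl fun j _ => ?_
    rw [← Fin.card_Iio j, ← Finset.prod_const]
    refine Finset.prod_congr rfl fun i hi => ?_
    rw [Finset.mem_Iio] at hi
    simp [hi.le]
  rw [h1, Fin.prod_univ_eq_prod_range (fun j => (-1 : ℤˣ) ^ j) n]
  clear h1
  induction n with
  | zero => simp
  | succ n ih =>
    rw [Finset.prod_range_succ, ih, ← pow_add]
    rcases Nat.even_or_odd' n with ⟨k, rfl | rfl⟩
    · rw [show (2 * k + 1) / 2 = k by omega, show 2 * k / 2 = k by omega, pow_add, pow_mul]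
      simp
    · rw [show (2 * k + 1 + 1) / 2 = k + 1 by omega, show (2 * k + 1) / 2 = k by omega,
        show k + (2 * k + 1) = k + 1 + 2 * k by omega, pow_add _ (k + 1), pow_mul]
      simp

/-- The coefficients `binom(e, r - q) X^(r - q) Y^(e - (r - q))`, banded by column. -/
noncomputable def bandMatrix (n m e : ℕ) : Matrix (Fin n) (Fin m) BiPoly :=
  Matrix.of fun r q => C ((if (q : ℕ) ≤ r then e.choose ((r : ℕ) - q) else 0 : ℕ) : ℝ) *
    X 0 ^ ((r : ℕ) - q) * X 1 ^ (e - ((r : ℕ) - q))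

/-- After the reversal, entry `(p, q)` has `X`-order `t = i - p + q`. Setting `k = i - p + r` gives
`k - t = r - q`, independent of `p`, so the sum over `k` is a matrix product. -/
theorem hessianMatrix_submatrix_rev {d i : ℕ} (hd : 2 * i ≤ d) {F : BiPoly}
    (hF : F.IsHomogeneous d) :
    (hessianMatrix i F).submatrix Fin.revPerm id =
      (C ((d.factorial : ℝ) / ((d - 2 * i).factorial : ℝ)) : BiPoly) •
        ((toeplitz d i F).map (C : ℝ →+* BiPoly) * bandMatrix (d - i + 1) (i + 1) (d - 2 * i)) := by
  ext1 p q
  have hp := p.2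
  have hq := q.2
  rw [Matrix.smul_apply, Matrix.submatrix_apply, hessianMatrix, Matrix.of_apply, smul_eq_mul]
  simp only [Fin.revPerm_apply, id, Fin.val_rev]
  rw [pderiv_iterate_form hd (by omega) hF, Matrix.mul_apply]
  congr 1
  simp only [Matrix.map_apply, toeplitz, bandMatrix, Matrix.of_apply]
  rw [Fin.sum_univ_eq_sum_range (fun r => C (normCoeff d F (i - (p : ℕ) + r)) *
    (C ((if (q : ℕ) ≤ r then (d - 2 * i).choose (r - q) else 0 : ℕ) : ℝ) *
    X 0 ^ (r - (q : ℕ)) * X 1 ^ (d - 2 * i - (r - (q : ℕ)))) : ℕ → BiPoly) (d - i + 1)]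
  have hsub : Finset.Ico (i - (p : ℕ)) (d - p + 1) ⊆ Finset.range (d + 1) := fun k hk => by
    rw [Finset.mem_Ico] at hk
    rw [Finset.mem_range]
    omega
  rw [← Finset.sum_subset hsub]
  · rw [Finset.sum_Ico_eq_sum_range, show d - p + 1 - (i - p) = d - i + 1 by omega]
    refine Finset.sum_congr rfl fun r _ => ?_
    rw [show i - (p : ℕ) + r - (i + 1 - (p + 1) + q) = r - q by omega]
    simp only [show i + 1 - ((p : ℕ) + 1) + q ≤ i - (p : ℕ) + r ↔ (q : ℕ) ≤ r by omega]
  · intro k _ hk2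
    rw [Finset.mem_Ico] at hk2
    have : (if i + 1 - ((p : ℕ) + 1) + q ≤ k then
        (d - 2 * i).choose (k - (i + 1 - ((p : ℕ) + 1) + q)) else 0) = 0 := by
      split_ifs with h
      · exact Nat.choose_eq_zero_of_lt (by omega)
      · rfl
    rw [this]
    simp

/-! ### Minors of the band matrix and the expansion -/

namespace SubsetsOf

variable {n m : ℕ}

theorem sum_val_add_size (J : SubsetsOf n m) :
    ∑ p : Fin m, (p : ℕ) + J.size = ∑ p, (J.1.orderEmbOfFin J.2 p : ℕ) := by
  unfold size part
  rw [← Equiv.sum_comp Fin.revPerm (fun p : Fin m => (p : ℕ)),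
    ← Equiv.sum_comp Fin.revPerm (fun p : Fin m => (J.1.orderEmbOfFin J.2 p : ℕ)),
    ← Finset.sum_add_distrib]
  refine Finset.sum_congr rfl fun p _ => ?_
  have := J.val_le_orderEmbOfFin p.rev
  simp only [Fin.revPerm_apply]
  omega

/-- In a nonzero Leibniz term the `X`-exponents sum to `∑ (j_(σ p) - p)`, which does not depend on
`σ` and equals `|λ(J)|`. -/
theorem det_bandMatrix_submatrix (J : SubsetsOf n m) :
    ((bandMatrix n m (n - m)).submatrix (J.1.orderEmbOfFin J.2) id).det =
      C J.weylNumber * X 0 ^ J.size * X 1 ^ (m * (n - m) - J.size) := by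
  set j : Fin m → ℕ := fun p => J.1.orderEmbOfFin J.2 p with hj
  have hsum := J.sum_val_add_size
  have hle := J.size_le
  rw [← binomDet_eq_weylNumber, binomDet, RingHom.map_det, Matrix.det_apply, Matrix.det_apply,
    Finset.sum_mul, Finset.sum_mul]
  refine Finset.sum_congr rfl fun σ _ => ?_
  rw [smul_mul_assoc, smul_mul_assoc]
  congr 1
  simp only [Matrix.submatrix_apply, bandMatrix, Matrix.of_apply, RingHom.mapMatrix_apply,
    Matrix.map_apply, id]
  by_cases h : ∀ p : Fin m, ((p : ℕ) ≤ j (σ p)) ∧ j (σ p) - p ≤ n - m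
  · rw [Finset.prod_mul_distrib, Finset.prod_mul_distrib, Finset.prod_pow_eq_pow_sum,
      Finset.prod_pow_eq_pow_sum]
    have h1 : ∑ p : Fin m, (j (σ p) - (p : ℕ)) = J.size := by
      have h2 : ∑ p : Fin m, (j (σ p) - (p : ℕ)) + ∑ p : Fin m, (p : ℕ) = ∑ p, j p := by
        rw [← Finset.sum_add_distrib, ← Equiv.sum_comp σ j]
        exact Finset.sum_congr rfl fun p _ => Nat.sub_add_cancel (h p).1
      simp only [hj] at h2 ⊢
      omega
    have h3 : ∑ p : Fin m, (n - m - (j (σ p) - (p : ℕ))) = m * (n - m) - J.size := by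
      have h4 : ∑ p : Fin m, (n - m - (j (σ p) - (p : ℕ))) + ∑ p : Fin m, (j (σ p) - (p : ℕ)) = m * (n - m) := by
        rw [← Finset.sum_add_distrib, Finset.sum_congr rfl fun p _ => Nat.sub_add_cancel (h p).2]
        simp
      omega
    simp only [hj] at h1 h3
    rw [h1, h3]
  · push Not at h
    obtain ⟨p, hp⟩ := h
    have h0 : (if (p : ℕ) ≤ j (σ p) then (n - m).choose (j (σ p) - p) else 0) = 0 := by
      split_ifs with h1
      · exact Nat.choose_eq_zero_of_lt (hp h1)
      · rfl
    simp only [hj] at h0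
    rw [Finset.prod_eq_zero (Finset.mem_univ p), Finset.prod_eq_zero (Finset.mem_univ p)]
    · simp
    · rw [h0]
      simp
    · rw [h0]
      simp

end SubsetsOf

theorem hessianPoly_eq_sum {d i : ℕ} (hd : 2 * i ≤ d) {F : BiPoly} (hF : F.IsHomogeneous d) :
    hessianPoly i F =
      C (((d.factorial : ℝ) / ((d - 2 * i).factorial : ℝ)) ^ (i + 1)) *
        ∑ J : SubsetsOf (d - i + 1) (i + 1),
          C (J.weylNumber * J.minor (toeplitz d i F)) * X 0 ^ J.size *
            X 1 ^ ((i + 1) * (d - 2 * i) - J.size) := by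
  have hnm : d - i + 1 - (i + 1) = d - 2 * i := by omega
  have h1 : hessianPoly i F = ((hessianMatrix i F).submatrix Fin.revPerm id).det := by
    rw [Matrix.det_permute, sign_revPerm, hessianPoly]
    simp
  rw [h1, hessianMatrix_submatrix_rev hd hF, Matrix.det_smul, Fintype.card_fin, C_pow,
    Matrix.det_mul_eq_sum_minors]
  refine congrArg _ (Finset.sum_congr rfl fun J _ => ?_)
  have h2 := J.det_bandMatrix_submatrix
  rw [hnm] at h2
  have h3 : (((toeplitz d i F).map (C : ℝ →+* BiPoly)).submatrix id (J.1.orderEmbOfFin J.2)).det =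
      (C (J.minor (toeplitz d i F)) : BiPoly) := by
    rw [SubsetsOf.minor, RingHom.map_det]
    rfl
  rw [h2, h3, C_mul]
  ring

/-! ### Bounds on the Hilbert function -/

theorem finrank_homogeneousSubmodule_fin_two_le (j : ℕ) :
    Module.finrank ℝ (homogeneousSubmodule (Fin 2) ℝ j) ≤ j + 1 := by
  let b : Fin (j + 1) → BiPoly := fun k => X 0 ^ (k : ℕ) * X 1 ^ (j - (k : ℕ))
  have hle : homogeneousSubmodule (Fin 2) ℝ j ≤ Submodule.span ℝ (Set.range b) := by
    intro f hf
    rw [mem_homogeneousSubmodule] at hf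
    rw [hf.eq_sum_fin_two]
    refine Submodule.sum_mem _ fun k hk => ?_
    rw [mul_assoc, C_mul']
    exact Submodule.smul_mem _ _ (Submodule.subset_span ⟨⟨k, Finset.mem_range.1 hk⟩, rfl⟩)
  have : Module.Finite ℝ (Submodule.span ℝ (Set.range b)) :=
    Module.Finite.span_of_finite ℝ (Set.finite_range b)
  refine (Submodule.finrank_mono hle).trans ?_
  exact (finrank_range_le_card (R := ℝ) b).trans_eq (Fintype.card_fin _)

instance finite_homogeneousSubmodule_fin_two (j : ℕ) :
    Module.Finite ℝ (homogeneousSubmodule (Fin 2) ℝ j) :=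
  Module.Finite.iff_fg.2 (homogeneousSubmodule_fg (Fin 2) ℝ j)

theorem MvPolynomial.IsHomogeneous.pderiv_iterate {d : ℕ} {F : BiPoly} (hF : F.IsHomogeneous d)
    (j : Fin 2) (t : ℕ) : ((pderiv j)^[t] F).IsHomogeneous (d - t) := by
  induction t with
  | zero => exact hF
  | succ t ih =>
    rw [Function.iterate_succ_apply', ← Nat.sub_sub]
    exact ih.pderiv

theorem diffAction_monomial (v : Fin 2 →₀ ℕ) (c : ℝ) :
    diffAction (monomial v c) = c • (partialD 0 ^ v 0 * partialD 1 ^ v 1) :=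
  AddMonoidAlgebra.lift_single _ _ _

theorem diffAction_isHomogeneous {d j : ℕ} {F f : BiPoly} (hF : F.IsHomogeneous d)
    (hf : f.IsHomogeneous j) : (diffAction f F).IsHomogeneous (d - j) := by
  rw [f.as_sum, map_sum, LinearMap.sum_apply]
  refine IsHomogeneous.sum _ _ _ fun v hv => ?_
  have h2 := hf (mem_support_iff.1 hv)
  rw [Finsupp.weight_apply, Finsupp.sum_fintype _ _ (by simp), Fin.sum_univ_two] at h2
  simp only [Pi.one_apply, smul_eq_mul, mul_one] at h2
  rw [diffAction_monomial, LinearMap.smul_apply, Module.End.mul_apply, Module.End.pow_apply,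
    Module.End.pow_apply]
  refine (homogeneousSubmodule (Fin 2) ℝ (d - j)).smul_mem _ ?_
  rw [← h2, add_comm, ← Nat.sub_sub]
  exact (hF.pderiv_iterate 1 _).pderiv_iterate 0 _

theorem hilbertFn_le_succ (F : BiPoly) (j : ℕ) : hilbertFn F j ≤ j + 1 :=
  (Submodule.finrank_map_le _ _).trans (finrank_homogeneousSubmodule_fin_two_le j)

/-- On forms of degree `j`, the quotient map and `f ↦ f ∘ F` have the same kernel, and the latter
lands in forms of degree `d - j`. -/
theorem hilbertFn_le_sub_succ {d : ℕ} {F : BiPoly} (hF : F.IsHomogeneous d) (j : ℕ) :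
    hilbertFn F j ≤ d - j + 1 := by
  let V := homogeneousSubmodule (Fin 2) ℝ j
  let g : V →ₗ[ℝ] AGAlgebra F := (Ideal.Quotient.mkₐ ℝ (annIdeal F)).toLinearMap.domRestrict V
  let ψ : V →ₗ[ℝ] BiPoly := (diffAction.toLinearMap.flip F).domRestrict V
  have hker : LinearMap.ker g = LinearMap.ker ψ := by
    ext f
    rw [LinearMap.mem_ker, LinearMap.mem_ker]
    exact Ideal.Quotient.eq_zero_iff_mem
  have hg := g.finrank_range_add_finrank_ker
  have hψ := ψ.finrank_range_add_finrank_ker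
  have hrange : hilbertFn F j = Module.finrank ℝ (LinearMap.range g) := by
    rw [hilbertFn, gradedPiece, LinearMap.range_domRestrict]
  have hle : LinearMap.range ψ ≤ homogeneousSubmodule (Fin 2) ℝ (d - j) := by
    rintro _ ⟨f, rfl⟩
    exact diffAction_isHomogeneous hF f.2
  have h1 := Submodule.finrank_mono hle
  have h2 := finrank_homogeneousSubmodule_fin_two_le (d - j)
  rw [hker] at hg
  have h3 : Module.finrank ℝ (LinearMap.range g) = Module.finrank ℝ (LinearMap.range ψ) := by
    omega
  rw [hrange, h3]
  exact h1.trans h2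

theorem two_mul_le_of_lt_spernerNumber {d i : ℕ} {F : BiPoly} (hF : F.IsHomogeneous d)
    (hi : i < spernerNumber d F) : 2 * i ≤ d := by
  obtain ⟨j, hj, hij⟩ := Finset.lt_sup_iff.1 hi
  have h1 := hilbertFn_le_succ F j
  have h2 := hilbertFn_le_sub_succ hF j
  rw [Finset.mem_range] at hj
  omega

theorem lemma2p7 (d : ℕ) (F : MvPolynomial (Fin 2) ℝ) (hF : F.IsHomogeneous d)
    (i : ℕ) (hi : i < spernerNumber d F) :
    2 * i ≤ d ∧
    (∀ J : SubsetsOf (d - i + 1) (i + 1),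
      J.size ≤ (i + 1) * (d - 2 * i) ∧
      J.weylNumber = (Nat.card (BoundedSSYT J.conjDiagram (d - 2 * i)) : ℝ)) ∧
    hessianPoly i F =
      MvPolynomial.C (((d.factorial : ℝ) / ((d - 2 * i).factorial : ℝ)) ^ (i + 1)) *
        ∑ J : SubsetsOf (d - i + 1) (i + 1),
          MvPolynomial.C (J.weylNumber * J.minor (toeplitz d i F)) *
            MvPolynomial.X 0 ^ J.size *
            MvPolynomial.X 1 ^ ((i + 1) * (d - 2 * i) - J.size) := by
  have hd := two_mul_le_of_lt_spernerNumber hF hi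
  have hnm : d - i + 1 - (i + 1) = d - 2 * i := by omega
  refine ⟨hd, fun J => ⟨?_, ?_⟩, hessianPoly_eq_sum hd hF⟩
  · have h := J.size_le
    rwa [hnm] at h
  · have h := J.weylNumber_eq_card
    rwa [hnm] at h
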